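/- Let $G$ be a finite connected simple undirected graph with $m$ edges, and let $d_v$ denote the degree of a vertex $v$. Consider the simple random walk on $G$: at each step it moves from the present vertex $v$ to a neighbour of $v$, each neighbour being chosen with probability $1/d_v$. Let $H(x,y)$ be the hitting time, i.e. the expected number of steps the walk needs to reach $y$ when started from $x$. If $xy$ is an edge of $G$, then $H(x,y)$ is finite and $$H(x,y)\le 2m-d_y .$$ The bound is sharp for path graphs: if $G$ is the path on $n\ge 2$ vertices, $y$ is an endpoint of it and $x$ is the neighbour of $y$, then $H(x,y)=2m-d_y$ (with $m=n-1$ and $d_y=1$). -/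

import Mathlib

open MeasureTheory ProbabilityTheory
open scoped ENNReal

noncomputable section

namespace SimpleGraph

/-- The distribution of one step of the simple random walk on `G` from the vertex `v`: each
neighbour of `v` is chosen with probability `1 / d_v`. By convention the walk stays put at an
isolated vertex. -/
def stepMeasure {V : Type*} [Fintype V] [MeasurableSpace V] (G : SimpleGraph V)
    [DecidableRel G.Adj] (v : V) : Measure V :=
  if G.degree v = 0 then Measure.dirac v
  else (G.degree v : ℝ≥0∞)⁻¹ • ∑ u ∈ G.neighborFinset v, Measure.dirac u

/-- The step distributions are probability measures. -/
theorem isProbabilityMeasure_stepMeasure {V : Type*} [Fintype V] [MeasurableSpace V]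
    (G : SimpleGraph V) [DecidableRel G.Adj] (v : V) :
    IsProbabilityMeasure (G.stepMeasure v) := by
  unfold stepMeasure
  split_ifs with h
  · infer_instance
  · constructor
    simp only [Measure.smul_apply, Measure.finsetSum_apply, measure_univ, Finset.sum_const,
      card_neighborFinset_eq_degree, nsmul_eq_mul, mul_one, smul_eq_mul]
    exact ENNReal.inv_mul_cancel (by exact_mod_cast h) (ENNReal.natCast_ne_top _)

/-- The transition kernel of the walk at time `n`: given the history `X_0, …, X_n`, the next
vertex is distributed according to the step distribution at the present vertex `X_n`. -/
def stepKernel {V : Type*} [Fintype V] [MeasurableSpace V] [DiscreteMeasurableSpace V]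
    (G : SimpleGraph V) [DecidableRel G.Adj] (n : ℕ) :
    Kernel ((i : Finset.Iic n) → (fun _ : ℕ => V) i) V where
  toFun h := G.stepMeasure (h ⟨n, Finset.mem_Iic.2 le_rfl⟩)
  measurable' := (Measurable.of_discrete (f := G.stepMeasure)).comp (measurable_pi_apply _)

instance isMarkovKernel_stepKernel {V : Type*} [Fintype V] [MeasurableSpace V]
    [DiscreteMeasurableSpace V] (G : SimpleGraph V) [DecidableRel G.Adj] (n : ℕ) :
    IsMarkovKernel (G.stepKernel n) :=
  ⟨fun _ => G.isProbabilityMeasure_stepMeasure _⟩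

/-- The law, on the space of trajectories `ℕ → V`, of the simple random walk on `G` started
at `x` (the measure given by the Ionescu-Tulcea theorem). -/
def randomWalk {V : Type*} [Fintype V] [MeasurableSpace V] [DiscreteMeasurableSpace V]
    (G : SimpleGraph V) [DecidableRel G.Adj] (x : V) : Measure (ℕ → V) :=
  Kernel.traj (X := fun _ : ℕ => V) G.stepKernel 0 (fun _ => x)

/-- The number of steps a trajectory needs to reach `y`, i.e. the least `n` with `ω n = y`
(and `⊤` if there is none). -/
def firstVisit {V : Type*} (y : V) (ω : ℕ → V) : ℕ∞ :=
  hittingAfter (fun (n : ℕ) (ω : ℕ → V) => ω n) {y} 0 ω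

/-- The hitting time `H(x, y)`: the expected number of steps the simple random walk on `G`
started at `x` needs to reach `y`. -/
def hittingTime {V : Type*} [Fintype V] [MeasurableSpace V] [DiscreteMeasurableSpace V]
    (G : SimpleGraph V) [DecidableRel G.Adj] (x y : V) : ℝ≥0∞ :=
  ∫⁻ ω, (firstVisit y ω : ℝ≥0∞) ∂(G.randomWalk x)

end SimpleGraph

end

noncomputable section

namespace SimpleGraph

/-! ### Tail sums of the first visit time -/

section FirstVisit

variable {V : Type*}

/-! Put h(v) = H(v, y), so h(y) = 0. First-step analysis gives d_v h(v) = d_v + ∑_{u ~ v} h(u) for v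
≠ y. Sum over v ≠ y: by double counting each h(u) occurs d_u times on the right, except that the
terms with u ~ y from v = y are missing. Cancelling leaves ∑_{u ~ y} h(u) = ∑_{v ≠ y} d_v = 2m -
d_y. H(x, y) is one of the nonnegative terms on the left, and the only one if y is an endpoint of a
path.

Cancelling needs finite sums, so the bound is proved for truncated expectations
(`sum_neighborFinset_le_of_subharmonic`), which are finite and satisfy the recursion as an
inequality, and then passes to the supremum. Connectedness spreads finiteness to all vertices, which
justifies the equality. -/

theorem lt_firstVisit_iff (y : V) (ω : ℕ → V) (n : ℕ) :
    (n : ℕ∞) < firstVisit y ω ↔ ∀ k ≤ n, ω k ≠ y := by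
  constructor
  · intro h k hk
    have hk' : ((k : ℕ) : WithTop ℕ) < hittingAfter (fun (n : ℕ) (ω : ℕ → V) => ω n) {y} 0 ω :=
      lt_of_le_of_lt (WithTop.coe_le_coe.2 hk) h
    simpa using notMem_of_lt_hittingAfter hk' (Nat.zero_le k)
  · intro h
    unfold firstVisit
    by_cases hex : ∃ j, 0 ≤ j ∧ ω j ∈ ({y} : Set V)
    · have hmem := Nat.sInf_mem (s := {i : ℕ | 0 ≤ i ∧ ω i ∈ ({y} : Set V)}) hex
      rw [hittingAfter, if_pos hex]
      refine WithTop.coe_lt_coe.2 ?_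
      by_contra hle
      exact h _ (not_lt.1 hle) hmem.2
    · rw [hittingAfter, if_neg hex]
      exact WithTop.coe_lt_top n

open Classical in
theorem _root_.ENat.toENNReal_eq_tsum (t : ℕ∞) :
    (t : ℝ≥0∞) = ∑' n : ℕ, if (n : ℕ∞) < t then 1 else 0 := by
  induction t using ENat.recTopCoe with
  | top => simp
  | coe a =>
    rw [tsum_eq_sum (s := Finset.range a) (fun n hn => by simpa using hn)]
    rw [Finset.sum_congr rfl (g := fun _ => (1 : ℝ≥0∞)) (fun n hn => by simpa using hn)]
    simp

end FirstVisit

section KilledStep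

variable {V : Type*} [Fintype V] [MeasurableSpace V] (G : SimpleGraph V) [DecidableRel G.Adj]

open Classical in
/-- The transition operator of the walk killed on leaving from `y`. -/
def killedStep (y : V) (f : V → ℝ≥0∞) (v : V) : ℝ≥0∞ :=
  if v = y then 0 else ∫⁻ u, f u ∂G.stepMeasure v

/-- The expectation of the hitting time of `y` truncated at `n`. -/
def truncatedHittingTime (y : V) (n : ℕ) (v : V) : ℝ≥0∞ :=
  ∑ k ∈ Finset.range n, (G.killedStep y)^[k + 1] (fun _ => 1) v

theorem truncatedHittingTime_mono (y v : V) :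
    Monotone fun n => G.truncatedHittingTime y n v := fun _ _ h =>
  Finset.sum_le_sum_of_subset (Finset.range_mono h)

theorem killedStep_self (y : V) (f : V → ℝ≥0∞) : G.killedStep y f y = 0 := by
  simp [killedStep]

theorem truncatedHittingTime_self (y : V) (n : ℕ) : G.truncatedHittingTime y n y = 0 := by
  simp [truncatedHittingTime, Function.iterate_succ_apply', killedStep_self]

theorem killedStep_one_iterate_le_one (y : V) (n : ℕ) (v : V) :
    (G.killedStep y)^[n] (fun _ => 1) v ≤ 1 := by
  induction n generalizing v with
  | zero => simp
  | succ n ih =>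
    rw [Function.iterate_succ_apply', killedStep]
    have := G.isProbabilityMeasure_stepMeasure v
    split_ifs
    · simp
    · exact (lintegral_mono ih).trans (by simp)

theorem truncatedHittingTime_ne_top (y : V) (n : ℕ) (v : V) :
    G.truncatedHittingTime y n v ≠ ∞ :=
  ENNReal.sum_ne_top.2 fun _ _ =>
    ne_top_of_le_ne_top ENNReal.one_ne_top (G.killedStep_one_iterate_le_one y _ v)

end KilledStep

/-! ### Markov property and first-step analysis -/

section Walk

variable {V : Type*} [Fintype V] [MeasurableSpace V] [DiscreteMeasurableSpace V]
  (G : SimpleGraph V) [DecidableRel G.Adj]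

theorem degree_mul_lintegral_stepMeasure (f : V → ℝ≥0∞) (v : V) :
    G.degree v * ∫⁻ u, f u ∂G.stepMeasure v = ∑ u ∈ G.neighborFinset v, f u := by
  unfold stepMeasure
  split_ifs with h
  · have : G.neighborFinset v = ∅ := by
      rwa [← Finset.card_eq_zero, card_neighborFinset_eq_degree]
    simp [h, this]
  · rw [lintegral_smul_measure, lintegral_finsetSum_measure, smul_eq_mul, ← mul_assoc,
      ENNReal.mul_inv_cancel (by exact_mod_cast h) (ENNReal.natCast_ne_top _), one_mul]
    simp [lintegral_dirac]

/-- The simple Markov property at time `n`, conditioning on the whole past. -/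
theorem lintegral_randomWalk_succ (x : V) (n : ℕ)
    {g : (Finset.Iic n → V) → ℝ≥0∞} (hg : Measurable g) (f : V → ℝ≥0∞) :
    ∫⁻ ω, g (Preorder.frestrictLe (π := fun _ => V) n ω) * f (ω (n + 1)) ∂G.randomWalk x =
      ∫⁻ ω, g (Preorder.frestrictLe (π := fun _ => V) n ω) * ∫⁻ u, f u ∂G.stepMeasure (ω n)
        ∂G.randomWalk x := by
  have hf : Measurable f := .of_discrete
  have hr : Measurable (Preorder.frestrictLe (π := fun _ : ℕ => V) n) :=
    Preorder.measurable_frestrictLe n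
  have hF : Measurable fun ω : ℕ → V =>
      g (Preorder.frestrictLe (π := fun _ => V) n ω) * f (ω (n + 1)) :=
    (hg.comp hr).mul (hf.comp (measurable_pi_apply _))
  have hP : Measurable fun v : V => ∫⁻ u, f u ∂G.stepMeasure v := .of_discrete
  have hH : Measurable fun h : Finset.Iic n → V =>
      g h * ∫⁻ u, f u ∂G.stepMeasure (h ⟨n, Finset.mem_Iic.2 le_rfl⟩) :=
    hg.mul (hP.comp (measurable_pi_apply _))
  have hcond (h : Finset.Iic n → V) :
      ∫⁻ ω, g (Preorder.frestrictLe (π := fun _ => V) n ω) * f (ω (n + 1))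
          ∂Kernel.traj (X := fun _ : ℕ => V) G.stepKernel n h =
        g h * ∫⁻ u, f u ∂G.stepMeasure (h ⟨n, Finset.mem_Iic.2 le_rfl⟩) := by
    -- Given the past `h`, the factor `g` is constant and only coordinate `n + 1` is random.
    have hpast (ω : ℕ → V) : Preorder.frestrictLe (π := fun _ => V) n
        (Function.updateFinset ω (Finset.Iic n) h) = h := by
      ext i
      simp [Preorder.frestrictLe, Function.updateFinset]
    have hnext (ω : ℕ → V) : Function.updateFinset ω (Finset.Iic n) h (n + 1) = ω (n + 1) := by
      simp [Function.updateFinset]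
    rw [Kernel.lintegral_traj _ hF]
    simp only [hpast, hnext]
    have hX : Measurable fun ω : ℕ → V => ω (n + 1) := measurable_pi_apply _
    rw [lintegral_const_mul (g h) (f := fun ω : ℕ → V => f (ω (n + 1))) (hf.comp hX),
      ← lintegral_map hf hX,
      ← Kernel.map_apply _ hX, Kernel.map_traj_succ_self]
    rfl
  have hmap := lintegral_map (μ := G.randomWalk x) hH hr
  calc _ = ∫⁻ h, g h * ∫⁻ u, f u ∂G.stepMeasure (h ⟨n, Finset.mem_Iic.2 le_rfl⟩)
        ∂Kernel.partialTraj (X := fun _ : ℕ => V) G.stepKernel 0 n (fun _ => x) := by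
        rw [randomWalk, ← Kernel.traj_comp_partialTraj (Nat.zero_le n),
          Kernel.lintegral_comp _ _ _ hF]
        exact lintegral_congr hcond
    _ = _ := by
        rw [← Kernel.traj_map_frestrictLe_apply]
        exact hmap

theorem lintegral_randomWalk_zero (x : V) (f : V → ℝ≥0∞) :
    ∫⁻ ω, f (ω 0) ∂G.randomWalk x = f x := by
  have hf : Measurable f := .of_discrete
  have : IsProbabilityMeasure (G.randomWalk x) := by unfold randomWalk; infer_instance
  have h := Kernel.lintegral_traj (X := fun _ : ℕ => V) (κ := G.stepKernel) (a := 0)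
    (fun _ => x) (hf.comp (measurable_pi_apply 0))
  have h0 : ∫⁻ ω, f (ω 0) ∂G.randomWalk x = ∫⁻ _, f x ∂G.randomWalk x := by
    refine Eq.trans h (lintegral_congr fun ω => ?_)
    simp [Function.updateFinset]
  rw [h0]
  simp

open Classical in
-- With `f = 1` this identifies iterates of `killedStep` with tail probabilities. The Markov
-- property absorbs the last step into `f`, hence the induction over all `f`.
theorem lintegral_randomWalk_killed (x y : V) (n : ℕ) (f : V → ℝ≥0∞) :
    ∫⁻ ω, (if ∀ k < n, ω k ≠ y then 1 else 0) * f (ω n) ∂G.randomWalk x =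
      (G.killedStep y)^[n] f x := by
  induction n generalizing f with
  | zero => simpa using G.lintegral_randomWalk_zero x f
  | succ n ih =>
    rw [Function.iterate_succ_apply, ← ih]
    let g : (Finset.Iic n → V) → ℝ≥0∞ := fun h => if ∀ k, h k ≠ y then 1 else 0
    have hg : Measurable g := .of_discrete
    have key (ω : ℕ → V) : g (Preorder.frestrictLe (π := fun _ => V) n ω) =
        if ∀ k < n + 1, ω k ≠ y then 1 else 0 := by
      refine if_congr ?_ rfl rfl
      simp [Preorder.frestrictLe]
    have h := G.lintegral_randomWalk_succ x n hg f
    simp only [key] at h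
    rw [h]
    refine lintegral_congr fun ω => ?_
    by_cases hn : ω n = y
    · have : ¬ ∀ k < n + 1, ω k ≠ y := fun h => h n n.lt_succ_self hn
      simp only [killedStep, hn, this, if_true, if_false, zero_mul, mul_zero]
    · have : (∀ k < n + 1, ω k ≠ y) ↔ ∀ k < n, ω k ≠ y :=
        ⟨fun h k hk => h k (hk.trans n.lt_succ_self), fun h k hk => by
          rcases Nat.lt_succ_iff_lt_or_eq.1 hk with hk | rfl
          exacts [h k hk, hn]⟩
      simp only [killedStep, hn, this, if_false]

theorem hittingTime_eq_tsum (x y : V) :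
    G.hittingTime x y = ∑' n : ℕ, (G.killedStep y)^[n + 1] (fun _ => 1) x := by
  classical
  have hmeas (n : ℕ) : Measurable fun ω : ℕ → V =>
      if ((n : ℕ) : ℕ∞) < firstVisit y ω then (1 : ℝ≥0∞) else 0 := by
    refine Measurable.ite ?_ measurable_const measurable_const
    simp only [lt_firstVisit_iff, Set.ofPred_forall]
    have hX (k : ℕ) : Measurable fun ω : ℕ → V => ω k := measurable_pi_apply k
    exact .iInter fun k => .iInter fun _ =>
      hX k (MeasurableSet.of_discrete (s := {v : V | v ≠ y}))
  unfold hittingTime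
  simp only [ENat.toENNReal_eq_tsum (firstVisit y _)]
  rw [lintegral_tsum fun n => (hmeas n).aemeasurable]
  refine tsum_congr fun n => ?_
  rw [← lintegral_randomWalk_killed]
  simp only [lt_firstVisit_iff, Nat.lt_succ_iff, mul_one]

theorem hittingTime_eq_iSup (x y : V) :
    G.hittingTime x y = ⨆ n, G.truncatedHittingTime y n x := by
  rw [hittingTime_eq_tsum, ENNReal.tsum_eq_iSup_nat]
  rfl

theorem hittingTime_self (y : V) : G.hittingTime y y = 0 := by
  simp [hittingTime_eq_iSup, truncatedHittingTime_self]

theorem degree_mul_killedStep {y v : V} (hv : v ≠ y) (f : V → ℝ≥0∞) :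
    G.degree v * G.killedStep y f v = ∑ u ∈ G.neighborFinset v, f u := by
  rw [killedStep, if_neg hv, degree_mul_lintegral_stepMeasure]

theorem degree_mul_truncatedHittingTime_succ {y v : V} (hv : v ≠ y) (n : ℕ) :
    G.degree v * G.truncatedHittingTime y (n + 1) v =
      G.degree v + ∑ u ∈ G.neighborFinset v, G.truncatedHittingTime y n u := by
  -- The split-off term `k = 0` yields the summand `G.degree v`.
  rw [truncatedHittingTime, Finset.sum_range_succ', mul_add, add_comm, Finset.mul_sum]
  congr 1
  · rw [Function.iterate_succ_apply', degree_mul_killedStep _ hv]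
    simp
  · simp only [truncatedHittingTime]
    rw [Finset.sum_comm]
    refine Finset.sum_congr rfl fun k _ => ?_
    rw [Function.iterate_succ_apply', degree_mul_killedStep _ hv]

/-- First-step analysis of the hitting time. -/
theorem degree_mul_hittingTime {y v : V} (hv : v ≠ y) :
    G.degree v * G.hittingTime v y =
      G.degree v + ∑ u ∈ G.neighborFinset v, G.hittingTime u y := by
  simp only [hittingTime_eq_iSup]
  rw [← (G.truncatedHittingTime_mono y v).iSup_nat_add 1, ENNReal.mul_iSup]
  simp only [degree_mul_truncatedHittingTime_succ _ hv]
  rw [← ENNReal.add_iSup, ENNReal.finsetSum_iSup_of_monotone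
    fun u => G.truncatedHittingTime_mono y u]

end Walk

/-! ### Double counting over neighbours -/

section DoubleCounting

variable {V : Type*} [Fintype V] (G : SimpleGraph V) [DecidableRel G.Adj]

theorem sum_sum_neighborFinset (f : V → ℝ≥0∞) :
    ∑ v, ∑ u ∈ G.neighborFinset v, f u = ∑ u, G.degree u * f u := by
  rw [Finset.sum_comm' (t' := Finset.univ) (s' := fun u => G.neighborFinset u)
    (by simp [G.adj_comm])]
  simp

theorem sum_degree_erase_add [DecidableEq V] (y : V) :
    ∑ v ∈ Finset.univ.erase y, G.degree v + G.degree y = 2 * G.edgeFinset.card := by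
  rw [Finset.sum_erase_add _ _ (Finset.mem_univ y), sum_degrees_eq_twice_card_edges]

theorem sum_neighborFinset_add_sum [DecidableEq V] (y : V) {f : V → ℝ≥0∞} (hy : f y = 0) :
    ∑ u ∈ G.neighborFinset y, f u +
        ∑ v ∈ Finset.univ.erase y, ∑ u ∈ G.neighborFinset v, f u =
      ∑ v ∈ Finset.univ.erase y, G.degree v * f v := by
  rw [Finset.add_sum_erase _ (fun v => ∑ u ∈ G.neighborFinset v, f u) (Finset.mem_univ y),
    sum_sum_neighborFinset,
    ← Finset.add_sum_erase _ _ (Finset.mem_univ y), hy, mul_zero, zero_add]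

theorem sum_neighborFinset_le_of_subharmonic [DecidableEq V] (y : V) {f : V → ℝ≥0∞}
    (hy : f y = 0) (hf : ∀ v, f v ≠ ∞)
    (h : ∀ v ≠ y, G.degree v * f v ≤ G.degree v + ∑ u ∈ G.neighborFinset v, f u) :
    ∑ u ∈ G.neighborFinset y, f u ≤ ∑ v ∈ Finset.univ.erase y, (G.degree v : ℝ≥0∞) := by
  have hfin : ∑ v ∈ Finset.univ.erase y, ∑ u ∈ G.neighborFinset v, f u ≠ ∞ :=
    ENNReal.sum_ne_top.2 fun _ _ => ENNReal.sum_ne_top.2 fun _ _ => hf _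
  rw [← ENNReal.add_le_add_iff_right hfin, sum_neighborFinset_add_sum G y hy,
    ← Finset.sum_add_distrib]
  exact Finset.sum_le_sum fun v hv => h v (Finset.ne_of_mem_erase hv)

theorem sum_neighborFinset_eq_of_harmonic [DecidableEq V] (y : V) {f : V → ℝ≥0∞}
    (hy : f y = 0) (hf : ∀ v, f v ≠ ∞)
    (h : ∀ v ≠ y, G.degree v * f v = G.degree v + ∑ u ∈ G.neighborFinset v, f u) :
    ∑ u ∈ G.neighborFinset y, f u = ∑ v ∈ Finset.univ.erase y, (G.degree v : ℝ≥0∞) := by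
  have hfin : ∑ v ∈ Finset.univ.erase y, ∑ u ∈ G.neighborFinset v, f u ≠ ∞ :=
    ENNReal.sum_ne_top.2 fun _ _ => ENNReal.sum_ne_top.2 fun _ _ => hf _
  rw [← ENNReal.add_left_inj hfin, sum_neighborFinset_add_sum G y hy,
    ← Finset.sum_add_distrib]
  exact Finset.sum_congr rfl fun v hv => h v (Finset.ne_of_mem_erase hv)

theorem toReal_sum_degree_erase [DecidableEq V] (y : V) :
    (∑ v ∈ Finset.univ.erase y, (G.degree v : ℝ≥0∞)).toReal =
      2 * (G.edgeFinset.card : ℝ) - G.degree y := by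
  have h := G.sum_degree_erase_add y
  rw [← Nat.cast_sum, ENNReal.toReal_natCast, eq_sub_iff_add_eq]
  exact_mod_cast h

end DoubleCounting

/-! ### Finiteness and the bound -/

section HittingTime

variable {V : Type*} [Fintype V] [MeasurableSpace V] [DiscreteMeasurableSpace V]
  (G : SimpleGraph V) [DecidableRel G.Adj]

theorem hittingTime_le_of_adj [DecidableEq V] {x y : V} (hxy : G.Adj x y) :
    G.hittingTime x y ≤ ∑ v ∈ Finset.univ.erase y, (G.degree v : ℝ≥0∞) := by
  rw [hittingTime_eq_iSup]
  refine iSup_le fun n => ?_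
  refine le_trans (Finset.single_le_sum (f := fun u => G.truncatedHittingTime y n u)
    (fun _ _ => zero_le) ((G.mem_neighborFinset y x).2 hxy.symm)) ?_
  refine G.sum_neighborFinset_le_of_subharmonic y (G.truncatedHittingTime_self y n)
    (G.truncatedHittingTime_ne_top y n) fun v hv => ?_
  rw [← degree_mul_truncatedHittingTime_succ G hv]
  gcongr
  exact G.truncatedHittingTime_mono y v n.le_succ

theorem hittingTime_ne_top_of_adj {x y : V} (hxy : G.Adj x y) : G.hittingTime x y ≠ ∞ := by
  classical
  exact ne_top_of_le_ne_top (ENNReal.sum_ne_top.2 fun _ _ => ENNReal.natCast_ne_top _)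
    (G.hittingTime_le_of_adj hxy)

theorem hittingTime_ne_top_of_reachable {x y : V} (h : G.Reachable y x) :
    G.hittingTime x y ≠ ∞ := by
  rw [reachable_iff_reflTransGen] at h
  induction h with
  | refl => simp [hittingTime_self]
  | @tail v u _ hvu ih =>
    -- The first-step identity fails at `y`, so neighbours of `y` use the bound for edges; elsewhere
    -- finiteness at `v` bounds every summand over its neighbours.
    by_cases hv : v = y
    · subst hv
      exact G.hittingTime_ne_top_of_adj hvu.symm
    · have hfin : (G.degree v : ℝ≥0∞) * G.hittingTime v y ≠ ∞ :=
        ENNReal.mul_ne_top (ENNReal.natCast_ne_top _) ih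
      rw [degree_mul_hittingTime G hv] at hfin
      exact ENNReal.sum_ne_top.1 (ENNReal.add_ne_top.1 hfin).2 u
        ((G.mem_neighborFinset v u).2 hvu)

/-- The mean return time identity: summing the hitting times of `y` over its neighbours. -/
theorem sum_hittingTime_neighborFinset [DecidableEq V] (hG : G.Preconnected) (y : V) :
    ∑ u ∈ G.neighborFinset y, G.hittingTime u y =
      ∑ v ∈ Finset.univ.erase y, (G.degree v : ℝ≥0∞) :=
  G.sum_neighborFinset_eq_of_harmonic y (f := fun u => G.hittingTime u y) (G.hittingTime_self y)
    (fun v => G.hittingTime_ne_top_of_reachable (hG y v)) fun _ hv => G.degree_mul_hittingTime hv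

end HittingTime

theorem neighborFinset_pathGraph_of_endpoint {n : ℕ} [DecidableRel (pathGraph n).Adj]
    {x y : Fin n} (hxy : (pathGraph n).Adj x y) (hy : y.val = 0 ∨ y.val + 1 = n) :
    (pathGraph n).neighborFinset y = {x} := by
  ext u
  rw [pathGraph_adj] at hxy
  rw [mem_neighborFinset, pathGraph_adj, Finset.mem_singleton, Fin.ext_iff]
  omega

end SimpleGraph

end

theorem corollary2p10 :
    (∀ {V : Type*} [Fintype V] [MeasurableSpace V] [DiscreteMeasurableSpace V]
        (G : SimpleGraph V) [DecidableRel G.Adj], G.Connected →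
        ∀ x y : V, G.Adj x y →
          G.hittingTime x y ≠ ∞ ∧
            (G.hittingTime x y).toReal ≤ 2 * (G.edgeFinset.card : ℝ) - (G.degree y : ℝ)) ∧
      ∀ (n : ℕ) [DecidableRel (SimpleGraph.pathGraph n).Adj] (x y : Fin n),
        (SimpleGraph.pathGraph n).Adj x y → (y.val = 0 ∨ y.val + 1 = n) →
          ((SimpleGraph.pathGraph n).hittingTime x y).toReal =
            2 * ((SimpleGraph.pathGraph n).edgeFinset.card : ℝ) -
              ((SimpleGraph.pathGraph n).degree y : ℝ) := by
  constructor
  · intro V _ _ _ G _ _ x y hxy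
    classical
    refine ⟨G.hittingTime_ne_top_of_adj hxy, ?_⟩
    rw [← G.toReal_sum_degree_erase y]
    exact ENNReal.toReal_mono
      (ENNReal.sum_ne_top.2 fun _ _ => ENNReal.natCast_ne_top _) (G.hittingTime_le_of_adj hxy)
  · intro n _ x y hxy hy
    have h := (SimpleGraph.pathGraph n).sum_hittingTime_neighborFinset
      (SimpleGraph.pathGraph_preconnected n) y
    rw [SimpleGraph.neighborFinset_pathGraph_of_endpoint hxy hy, Finset.sum_singleton] at h
    rw [h, SimpleGraph.toReal_sum_degree_erase]
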